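/- Let $[n]=\{1,\dots,n\}$. For a poset $P$, a family $\mathcal F$ of subsets of $[n]$ is called $P$-free if $\mathcal F$, ordered by inclusion, does not contain $P$ as an induced subposet. Let $\mathrm{La}^*(n,P)$ be the maximum size of a $P$-free family of subsets of $[n]$, and let $\pi^*(P)=\limsup_{n\to\infty}\mathrm{La}^*(n,P)/\binom{n}{\lfloor n/2\rfloor}$. The Lubell mass $\ell(\mathcal F)$ of a family $\mathcal F$ of subsets of $[n]$ is the expected number of members of $\mathcal F$ on a uniformly random maximal chain of the inclusion order of all subsets of $[n]$, that is, $\ell(\mathcal F)=\sum_{A\in\mathcal F}1/\binom{n}{|A|}$. Let $\Lambda^*(P)$ be the supremum of $\ell(\mathcal F)$ over all $n\ge 0$ and all $P$-free families $\mathcal F$ of subsets of $[n]$. For $r\ge 1$ the standard example $S_r$ is the poset on $2r$ elements $a_1,\dots,a_r,b_1,\dots,b_r$ in which $\{a_1,\dots,a_r\}$ and $\{b_1,\dots,b_r\}$ are antichains, $b_j\le a_i$ if and only if $i\ne j$, and $a_i\le b_j$ never holds. Theorem. For every integer $r\ge 1$, $$r-2\;\le\;\pi^*(S_r)\;\le\;\Lambda^*(S_r)\;\le\;2r+\sqrt{(16\ln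 2)\,r}+11 .$$ In particular, every family $\mathcal F$ of subsets of $[n]$ (for any $n$) with $\ell(\mathcal F)>2r+\sqrt{(16\ln 2)\,r}+11$ contains $S_r$ as an induced subposet. Moreover, for $r\ge 2$, the union of any $r-2$ consecutive levels $\binom{[n]}{k},\dots,\binom{[n]}{k+r-3}$ is $S_r$-free, and the size of the union of the $r-2$ middle levels divided by $\binom{n}{\lfloor n/2\rfloor}$ tends to $r-2$ as $n\to\infty$. -/

import Mathlib

open Filter Topology

/-- The underlying set of the standard example `S_r`: the elements `a_1, …, a_r` and
`b_1, …, b_r`. -/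
inductive StdEx (r : ℕ) : Type
  | a : Fin r → StdEx r
  | b : Fin r → StdEx r

/-- The order of the standard example: `a`'s and `b`'s are antichains, and the only comparabilities
between them are `b_j ≤ a_i` for `i ≠ j`. -/
def StdEx.le {r : ℕ} : StdEx r → StdEx r → Prop
  | .a i, .a j => i = j
  | .b i, .b j => i = j
  | .b j, .a i => i ≠ j
  | .a _, .b _ => False

instance StdEx.instPartialOrder (r : ℕ) : PartialOrder (StdEx r) where
  le := StdEx.le
  le_refl x := by cases x <;> rfl
  le_trans x y z hxy hyz := by
    cases x <;> cases y <;> cases z <;> simp_all [StdEx.le]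
  le_antisymm x y hxy hyx := by
    cases x <;> cases y <;> simp_all [StdEx.le]

/-- The family `F`, ordered by inclusion, contains a copy of `P` as an induced subposet. -/
def ContainsCopy (P : Type*) [PartialOrder P] {n : ℕ} (F : Finset (Finset (Fin n))) : Prop :=
  Nonempty (P ↪o {A : Finset (Fin n) // A ∈ F})

/-- `F` is (induced) `P`-free. -/
def PosetFree (P : Type*) [PartialOrder P] {n : ℕ} (F : Finset (Finset (Fin n))) : Prop :=
  ¬ ContainsCopy P F

open Classical in
/-- The Turán function `La*(n, P)`: the maximum size of a `P`-free family of subsets of an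
`n`-element set. -/
noncomputable def laStar (n : ℕ) (P : Type*) [PartialOrder P] : ℕ :=
  (Finset.univ.filter fun F : Finset (Finset (Fin n)) => PosetFree P F).sup Finset.card

/-- The Turán threshold `π*(P)`, as an extended real number. -/
noncomputable def turanThreshold (P : Type*) [PartialOrder P] : EReal :=
  limsup (fun n : ℕ => (((laStar n P : ℝ) / (n.choose (n / 2) : ℝ) : ℝ) : EReal)) atTop

open Classical in
/-- The Lubell function of `F`: the expected number of members of `F` on a uniformly random maximal
chain of the Boolean lattice. The maximal chains correspond bijectively to the numberings of the
ground set: the chain of a numbering consists of its prefixes. -/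
noncomputable def lubell {n : ℕ} (F : Finset (Finset (Fin n))) : ℝ :=
  (∑ f : Numbering (Fin n), ((F.filter fun A => f.IsPrefix A).card : ℝ)) /
    (Fintype.card (Numbering (Fin n)) : ℝ)

/-- The usual formula for the Lubell function. -/
theorem lubell_eq_sum {n : ℕ} (F : Finset (Finset (Fin n))) :
    lubell F = ∑ A ∈ F, 1 / (n.choose A.card : ℝ) := by
  classical
  have h : ∀ A : Finset (Fin n), ((Numbering.prefixed A).card : ℝ) /
      (Fintype.card (Numbering (Fin n)) : ℝ) = 1 / (n.choose A.card : ℝ) := by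
    intro A
    have hA : A.card ≤ n := by simpa using A.card_le_univ
    rw [Numbering.card_prefixed, Fintype.card_numbering, Nat.cast_choose ℝ hA]
    simp
  rw [lubell, ← Finset.sum_congr rfl fun A _ => h A, ← Finset.sum_div]
  congr 1
  simp only [Finset.card_filter, Numbering.prefixed, Nat.cast_sum]
  rw [Finset.sum_comm]

/-- The strong Lubell threshold `Λ*(P)`: the supremum, over all `n`, of the Lubell masses of the
`P`-free families of subsets of an `n`-element set, as an extended real number. -/
noncomputable def strongLubellThreshold (P : Type*) [PartialOrder P] : EReal :=
  sSup {x : EReal | ∃ (n : ℕ) (F : Finset (Finset (Fin n))),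
    PosetFree P F ∧ x = ((lubell F : ℝ) : EReal)}

/-- The union of the `m` consecutive levels `k, k + 1, …, k + m - 1` of the Boolean lattice on
`n` elements. -/
def levels (n k m : ℕ) : Finset (Finset (Fin n)) :=
  Finset.univ.filter fun A => k ≤ A.card ∧ A.card < k + m

/-- The union of the `m` middle levels of the Boolean lattice on `n` elements (for `m ≤ n + 1`). -/
def middleLevels (n m : ℕ) : Finset (Finset (Fin n)) :=
  levels n ((n + 1 - m) / 2) m

/-! The upper bound comes from a self-improving estimate for Λ, the largest average of `hitCount`
over all intervals [Y, Y ∪ U], where the average is over the orders of U, that is, over the maximal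
chains of the interval.

On a chain let P be its (j + 1)-st member of F and Q its (j + 1)-st member from the end. An element
x added between them is good if some B in F has x ∈ B ⊆ P ∪ {x} and some A in F has Q \ {x} ⊆ A and
x ∉ A. More than r good elements produce S_r (`containsCopy_of_good`). So the chain has at most r +
2j + 1 members of F, plus the number of bad elements that lead into F (`hitCount_le_of_fewGood`).
Badness at Q is badness at its complement in the complementary family, on the reversed chain, so one
side suffices.

Given P, a fixed x leads into F with probability at most Λ / |U|, by moving x to the front of the
order. The next entry is bad with probability (number of bad x) / |U|. Hence the expected number of
bad entries leading into F is at most Λ times the probability that the entry right after P is bad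
(`sum_badCount_le`, `sum_atHit_le`). This probability is at most 1 / (j + 1)
(`sum_atHit_headBad_le`): the last j + 1 entries of a random order are fed in one at a time at
visits to F, and at most a 1 / (j + 1) fraction of their orders leaves a bad entry for the last such
visit.

With j = 3 this gives Λ ≤ r + 7 + Λ/4 + Λ/4, so Λ ≤ 2r + 14, which is below the stated bound because
√(16 r ln 2) ≥ 3.

The lower bound comes from levels: in a copy of S_r some a-set exceeds some b-set by at least r - 2
elements, so r - 2 consecutive levels contain no copy. -/

/-! ### Sums over all orders of a finite set -/

section Orders

variable {α : Type*} [DecidableEq α]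

/-- The set of all enumerations of a finite set as duplicate-free lists. -/
def orders (U : Finset α) : Finset (List α) :=
  ⟨Multiset.lists U.val, Multiset.lists_nodup_finset U⟩

theorem mem_orders {U : Finset α} {l : List α} :
    l ∈ orders U ↔ l.Nodup ∧ l.toFinset = U := by
  change l ∈ Multiset.lists U.val ↔ _
  rw [Multiset.mem_lists_iff]
  constructor
  · intro h
    have h' : U.val = (l : Multiset α) := h
    have hn : l.Nodup := by
      rw [← Multiset.coe_nodup, ← h']
      exact U.nodup
    refine ⟨hn, ?_⟩
    ext x
    rw [List.mem_toFinset, ← Multiset.mem_coe, ← h', Finset.mem_val]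
  · rintro ⟨hn, rfl⟩
    change l.toFinset.val = (l : Multiset α)
    rw [List.toFinset_val, hn.dedup]

theorem length_of_mem_orders {U : Finset α} {l : List α} (h : l ∈ orders U) :
    l.length = U.card := by
  obtain ⟨hn, rfl⟩ := mem_orders.1 h
  rw [List.toFinset_card_of_nodup hn]

theorem orders_empty : orders (∅ : Finset α) = {[]} := by
  ext l
  rw [mem_orders, Finset.mem_singleton]
  constructor
  · rintro ⟨_, h⟩
    simpa using h
  · rintro rfl
    simp

theorem cons_mem_orders {U : Finset α} {x : α} {l : List α} :
    x :: l ∈ orders U ↔ x ∈ U ∧ l ∈ orders (U.erase x) := by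
  simp only [mem_orders, List.nodup_cons, List.toFinset_cons]
  constructor
  · rintro ⟨⟨hx, hn⟩, rfl⟩
    refine ⟨Finset.mem_insert_self _ _, hn, ?_⟩
    rw [Finset.erase_insert]
    simpa using hx
  · rintro ⟨hx, hn, hl⟩
    refine ⟨⟨?_, hn⟩, ?_⟩
    · intro h
      have := List.mem_toFinset.2 h
      rw [hl] at this
      simp at this
    · rw [hl, Finset.insert_erase hx]

/-- Conditioning on the first entry; most inductions over random chains rest on this. -/
theorem sum_orders_cons {β : Type*} [AddCommMonoid β] {U : Finset α} (hU : U.Nonempty)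
    (g : List α → β) :
    ∑ l ∈ orders U, g l = ∑ x ∈ U, ∑ l ∈ orders (U.erase x), g (x :: l) := by
  rw [Finset.sum_sigma']
  symm
  refine Finset.sum_bij (fun p _ => p.1 :: p.2) ?_ ?_ ?_ ?_
  · rintro ⟨x, l⟩ h
    rw [Finset.mem_sigma] at h
    exact cons_mem_orders.2 h
  · rintro ⟨x, l⟩ _ ⟨y, m⟩ _ h
    simp only [List.cons.injEq] at h
    obtain ⟨rfl, rfl⟩ := h
    rfl
  · intro l hl
    cases l with
    | nil =>
      have := length_of_mem_orders hl
      rw [List.length_nil] at this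
      exact absurd this.symm (Finset.card_ne_zero_of_mem hU.choose_spec)
    | cons x l => exact ⟨⟨x, l⟩, Finset.mem_sigma.2 (cons_mem_orders.1 hl), rfl⟩
  · intros
    rfl

theorem card_orders (U : Finset α) : (orders U).card = U.card.factorial := by
  induction hn : U.card generalizing U with
  | zero =>
    rw [Finset.card_eq_zero] at hn
    subst hn
    simp [orders_empty]
  | succ n ih =>
    have hU : U.Nonempty := Finset.card_pos.1 (by omega)
    rw [Finset.card_eq_sum_ones, sum_orders_cons hU]
    have h : ∀ x ∈ U, ∑ l ∈ orders (U.erase x), 1 = n.factorial := by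
      intro x hx
      rw [← Finset.card_eq_sum_ones]
      exact ih _ (by rw [Finset.card_erase_of_mem hx]; omega)
    rw [Finset.sum_congr rfl h, Finset.sum_const, hn, Nat.factorial_succ, smul_eq_mul]

/-- Summation over all enumerations is invariant under an injective rearrangement. -/
theorem sum_orders_comp {β : Type*} [AddCommMonoid β] {U : Finset α} (φ : List α → List α)
    (hperm : ∀ l ∈ orders U, (φ l).Perm l) (hinj : Set.InjOn φ (orders U : Set (List α)))
    (g : List α → β) : ∑ l ∈ orders U, g (φ l) = ∑ l ∈ orders U, g l := by
  have hmaps : ∀ l ∈ orders U, φ l ∈ orders U := by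
    intro l hl
    obtain ⟨hn, ht⟩ := mem_orders.1 hl
    refine mem_orders.2 ⟨(hperm l hl).nodup_iff.2 hn, ?_⟩
    rw [List.toFinset_eq_of_perm _ _ (hperm l hl), ht]
  have himg : (orders U).image φ = orders U :=
    Finset.eq_of_subset_of_card_le (Finset.image_subset_iff.2 hmaps)
      (by rw [Finset.card_image_of_injOn hinj])
  conv_rhs => rw [← himg]
  rw [Finset.sum_image hinj]

theorem sum_orders_reverse {β : Type*} [AddCommMonoid β] (U : Finset α) (g : List α → β) :
    ∑ l ∈ orders U, g l.reverse = ∑ l ∈ orders U, g l :=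
  sum_orders_comp List.reverse (fun l _ => l.reverse_perm)
    (List.reverse_injective.injOn) g

/-- To bound a sum over all enumerations, cut off the last `j` entries and bound the sum over
their rearrangements. -/
theorem sum_orders_le_of_suffix (j : ℕ) (c : ℝ) (g : List α → List α → ℝ)
    (hg : ∀ (E : List α) (ε : Finset α), ε.card = j → ∑ es ∈ orders ε, g E es ≤ c * j.factorial)
    (d : ℕ) (U : Finset α) (hU : U.card = d + j) :
    ∑ l ∈ orders U, g (l.take d) (l.drop d) ≤ c * (d + j).factorial := by
  induction d generalizing U g with
  | zero =>
    simpa using hg [] U (by omega)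
  | succ d ih =>
    have hne : U.Nonempty := Finset.card_pos.1 (by omega)
    rw [sum_orders_cons hne]
    have h : ∀ x ∈ U, ∑ l ∈ orders (U.erase x), g ((x :: l).take (d + 1)) ((x :: l).drop (d + 1))
        ≤ c * (d + j).factorial := by
      intro x hx
      simp only [List.take_succ_cons, List.drop_succ_cons]
      exact ih (fun E es => g (x :: E) es) (fun E ε hε => hg _ ε hε) _
        (by rw [Finset.card_erase_of_mem hx]; omega)
    refine (Finset.sum_le_sum h).trans ?_
    rw [Finset.sum_const, hU, nsmul_eq_mul, show d + 1 + j = (d + j) + 1 by ring,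
      Nat.factorial_succ]
    push_cast
    apply le_of_eq
    ring

end Orders

/-! ### Hits of a chain and the expected number of bad entries -/

section Hits

variable {α : Type*} [DecidableEq α]

/-- The number of members of `F` on the chain that starts at `Y` and adds the entries of a list
one by one. -/
def hitCount (F : Finset (Finset α)) : Finset α → List α → ℕ
  | Y, [] => if Y ∈ F then 1 else 0
  | Y, x :: l => (if Y ∈ F then 1 else 0) + hitCount F (insert x Y) l

/-- The entries of the list whose addition leads to a member of `F`. -/
def hitEntries (F : Finset (Finset α)) : Finset α → List α → List α
  | _, [] => []
  | Y, x :: l =>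
    if insert x Y ∈ F then x :: hitEntries F (insert x Y) l else hitEntries F (insert x Y) l

/-- The entries of the list that are added to a member of `F`. -/
def leaveEntries (F : Finset (Finset α)) : Finset α → List α → List α
  | _, [] => []
  | Y, x :: l =>
    if Y ∈ F then x :: leaveEntries F (insert x Y) l else leaveEntries F (insert x Y) l

/-- No member of `F` contains `x` and is contained in `P ∪ {x}`. -/
def Bad (F : Finset (Finset α)) (P : Finset α) (x : α) : Prop :=
  ∀ B ∈ F, x ∈ B → ¬ B ⊆ insert x P

instance (F : Finset (Finset α)) (P : Finset α) (x : α) : Decidable (Bad F P x) := by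
  unfold Bad
  infer_instance

/-- The value of `h` at the moment when the chain meets its `(j + 1)`-st member of `F`. -/
def atHit (F : Finset (Finset α)) (h : Finset α → List α → ℕ) : ℕ → Finset α → List α → ℕ
  | j, Y, [] => if Y ∈ F ∧ j = 0 then h Y [] else 0
  | j, Y, x :: l =>
    if Y ∈ F then (if j = 0 then h Y (x :: l) else atHit F h (j - 1) (insert x Y) l)
    else atHit F h j (insert x Y) l

/-- The indicator that the first entry of the list is bad. -/
def headBad (F : Finset (Finset α)) (Y : Finset α) : List α → ℕ
  -- Nothing is added at the top of the chain, so a visit to F there contributes zero.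
  | [] => 0
  | x :: _ => if Bad F Y x then 1 else 0

theorem Bad.anti {F : Finset (Finset α)} {P Q : Finset α} {x : α} (h : Bad F Q x) (hPQ : P ⊆ Q) :
    Bad F P x := fun B hB hx hs => h B hB hx (hs.trans (Finset.insert_subset_insert _ hPQ))

theorem hitEntries_sublist (F : Finset (Finset α)) (Y : Finset α) (l : List α) :
    (hitEntries F Y l).Sublist l := by
  induction l generalizing Y with
  | nil => simp [hitEntries]
  | cons x l ih =>
    rw [hitEntries]
    split_ifs
    · exact (ih _).cons_cons x
    · exact (ih _).cons x

theorem leaveEntries_sublist (F : Finset (Finset α)) (Y : Finset α) (l : List α) :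
    (leaveEntries F Y l).Sublist l := by
  induction l generalizing Y with
  | nil => simp [leaveEntries]
  | cons x l ih =>
    rw [leaveEntries]
    split_ifs
    · exact (ih _).cons_cons x
    · exact (ih _).cons x

theorem hitCount_eq (F : Finset (Finset α)) (Y : Finset α) (l : List α) :
    hitCount F Y l = (if Y ∈ F then 1 else 0) + (hitEntries F Y l).length := by
  induction l generalizing Y with
  | nil => simp [hitCount, hitEntries]
  | cons x l ih =>
    rw [hitCount, ih, hitEntries]
    by_cases h : insert x Y ∈ F <;> simp [h, add_comm]

/-- Move x to the front: an order in which adding x leads into F corresponds to an order of the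
other elements together with a marked hit of its chain started at Y ∪ {x}. The induction splits on
whether x comes first. -/
theorem sum_mem_hitEntries (F : Finset (Finset α)) (Y U : Finset α) (x : α) (hx : x ∈ U) :
    ∑ l ∈ orders U, (if x ∈ hitEntries F Y l then 1 else 0) =
      ∑ l ∈ orders (U.erase x), hitCount F (insert x Y) l := by
  induction hn : U.card generalizing U Y with
  | zero => simp_all
  | succ n ih =>
    rw [sum_orders_cons ⟨x, hx⟩, ← Finset.add_sum_erase _ _ hx]
    have h1 : ∑ l ∈ orders (U.erase x), (if x ∈ hitEntries F Y (x :: l) then 1 else 0) =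
        ∑ l ∈ orders (U.erase x), (if insert x Y ∈ F then 1 else 0) := by
      refine Finset.sum_congr rfl fun l hl => ?_
      have hxl : x ∉ hitEntries F (insert x Y) l := by
        intro h
        have h := (hitEntries_sublist F _ _).subset h
        obtain ⟨_, ht⟩ := mem_orders.1 hl
        rw [← List.mem_toFinset, ht] at h
        simp at h
      rw [hitEntries]
      by_cases h : insert x Y ∈ F <;> simp [h, hxl]
    have h2 : ∀ y ∈ U.erase x,
        ∑ l ∈ orders (U.erase y), (if x ∈ hitEntries F Y (y :: l) then 1 else 0) =
        ∑ l ∈ orders ((U.erase x).erase y), hitCount F (insert y (insert x Y)) l := by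
      intro y hy
      have hyx : y ≠ x := Finset.ne_of_mem_erase hy
      have hyU : y ∈ U := Finset.mem_of_mem_erase hy
      rw [Finset.erase_right_comm, Finset.insert_comm,
        ← ih _ _ (Finset.mem_erase.2 ⟨hyx.symm, hx⟩) (by rw [Finset.card_erase_of_mem hyU]; omega)]
      refine Finset.sum_congr rfl fun l hl => ?_
      rw [hitEntries]
      by_cases h : insert y Y ∈ F <;> simp [h, hyx.symm]
    rw [h1, Finset.sum_congr rfl h2]
    rcases (U.erase x).eq_empty_or_nonempty with he | he
    · rw [he]
      simp [orders_empty, hitCount]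
    · have h3 : ∀ l : List α, ∀ y, hitCount F (insert x Y) (y :: l) =
          (if insert x Y ∈ F then 1 else 0) + hitCount F (insert y (insert x Y)) l :=
        fun _ _ => rfl
      rw [sum_orders_cons he, sum_orders_cons he]
      simp only [h3, Finset.sum_add_distrib]

/-- Dual to `sum_mem_hitEntries`: deleting x from the order marks the member of F to which x was
added, on a chain that avoids x. -/
theorem sum_mem_leaveEntries (F : Finset (Finset α)) (Y U : Finset α) (x : α) (hx : x ∈ U) :
    ∑ l ∈ orders U, (if x ∈ leaveEntries F Y l then 1 else 0) =
      ∑ l ∈ orders (U.erase x), hitCount F Y l := by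
  induction hn : U.card generalizing U Y with
  | zero => simp_all
  | succ n ih =>
    rw [sum_orders_cons ⟨x, hx⟩, ← Finset.add_sum_erase _ _ hx]
    have h1 : ∑ l ∈ orders (U.erase x), (if x ∈ leaveEntries F Y (x :: l) then 1 else 0) =
        ∑ l ∈ orders (U.erase x), (if Y ∈ F then 1 else 0) := by
      refine Finset.sum_congr rfl fun l hl => ?_
      have hxl : x ∉ leaveEntries F (insert x Y) l := by
        intro h
        have h := (leaveEntries_sublist F _ _).subset h
        obtain ⟨_, ht⟩ := mem_orders.1 hl
        rw [← List.mem_toFinset, ht] at h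
        simp at h
      rw [leaveEntries]
      by_cases h : Y ∈ F <;> simp [h, hxl]
    have h2 : ∀ y ∈ U.erase x,
        ∑ l ∈ orders (U.erase y), (if x ∈ leaveEntries F Y (y :: l) then 1 else 0) =
        ∑ l ∈ orders ((U.erase x).erase y), hitCount F (insert y Y) l := by
      intro y hy
      have hyx : y ≠ x := Finset.ne_of_mem_erase hy
      have hyU : y ∈ U := Finset.mem_of_mem_erase hy
      rw [Finset.erase_right_comm,
        ← ih _ _ (Finset.mem_erase.2 ⟨hyx.symm, hx⟩) (by rw [Finset.card_erase_of_mem hyU]; omega)]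
      refine Finset.sum_congr rfl fun l hl => ?_
      rw [leaveEntries]
      by_cases h : Y ∈ F <;> simp [h, hyx.symm]
    rw [h1, Finset.sum_congr rfl h2]
    rcases (U.erase x).eq_empty_or_nonempty with he | he
    · rw [he]
      simp [orders_empty, hitCount]
    · have h3 : ∀ l : List α, ∀ y, hitCount F Y (y :: l) =
          (if Y ∈ F then 1 else 0) + hitCount F (insert y Y) l :=
        fun _ _ => rfl
      rw [sum_orders_cons he, sum_orders_cons he]
      simp only [h3, Finset.sum_add_distrib]

/-- The number of bad entries among the entries selected by `e`. -/
def badCount (F : Finset (Finset α)) (e : Finset α → List α → List α) (Y : Finset α)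
    (l : List α) : ℕ :=
  ((e Y l).filter fun x => Bad F Y x).length

theorem sum_headBad (F : Finset (Finset α)) (Y U : Finset α) :
    ∑ l ∈ orders U, headBad F Y l =
      ∑ x ∈ U with Bad F Y x, (U.card - 1).factorial := by
  rcases U.eq_empty_or_nonempty with rfl | hU
  · simp [orders_empty, headBad]
  · rw [sum_orders_cons hU, Finset.sum_filter]
    refine Finset.sum_congr rfl fun x hx => ?_
    simp only [headBad, Finset.sum_const, card_orders, Finset.card_erase_of_mem hx, smul_eq_mul]
    split_ifs <;> simp

/-- By linearity the left side sums, over bad x, the number of orders in which x is selected, at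
most Λ (|U| - 1)! each; and (|U| - 1)! is exactly the number of orders that start with x. -/
theorem sum_badCount_le (F : Finset (Finset α)) (e : Finset α → List α → List α)
    (he : ∀ Y l, (e Y l).Sublist l) (Λ : ℝ) (Y U : Finset α)
    (hΛ : ∀ x ∈ U, ((∑ l ∈ orders U, if x ∈ e Y l then 1 else 0 : ℕ) : ℝ) ≤
      Λ * (U.card - 1).factorial) :
    ((∑ l ∈ orders U, badCount F e Y l : ℕ) : ℝ) ≤
      Λ * ((∑ l ∈ orders U, headBad F Y l : ℕ) : ℝ) := by
  have h : ∑ l ∈ orders U, badCount F e Y l =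
      ∑ x ∈ U with Bad F Y x, ∑ l ∈ orders U, if x ∈ e Y l then 1 else 0 := by
    rw [Finset.sum_comm]
    refine Finset.sum_congr rfl fun l hl => ?_
    obtain ⟨hn, rfl⟩ := mem_orders.1 hl
    rw [← Finset.sum_filter, ← Finset.card_eq_sum_ones, badCount,
      ← List.toFinset_card_of_nodup (((he Y l).nodup hn).filter _)]
    congr 1
    ext x
    simp only [List.mem_toFinset, List.mem_filter, decide_eq_true_eq, Finset.mem_filter]
    constructor
    · rintro ⟨h1, h2⟩
      exact ⟨⟨(he Y l).subset h1, h2⟩, h1⟩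
    · rintro ⟨⟨_, h2⟩, h1⟩
      exact ⟨h1, h2⟩
  rw [h, sum_headBad]
  push_cast
  rw [Finset.mul_sum]
  refine Finset.sum_le_sum fun x hx => ?_
  have := hΛ x (Finset.mem_filter.1 hx).1
  push_cast at this
  exact this

/-- The (j + 1)-st hit is a stopping time, after which the remaining order is uniform. An inequality
valid on every interval therefore survives evaluation at that hit. -/
theorem sum_atHit_le (F : Finset (Finset α)) (h₁ h₂ : Finset α → List α → ℕ) (Λ : ℝ)
    (h : ∀ Y U : Finset α, Disjoint Y U → ((∑ l ∈ orders U, h₁ Y l : ℕ) : ℝ) ≤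
      Λ * ((∑ l ∈ orders U, h₂ Y l : ℕ) : ℝ)) (j : ℕ) (Y U : Finset α) (hYU : Disjoint Y U) :
    ((∑ l ∈ orders U, atHit F h₁ j Y l : ℕ) : ℝ) ≤
      Λ * ((∑ l ∈ orders U, atHit F h₂ j Y l : ℕ) : ℝ) := by
  induction hn : U.card generalizing U Y j with
  | zero =>
    rw [Finset.card_eq_zero] at hn
    subst hn
    have := h Y ∅ hYU
    simp only [orders_empty, Finset.sum_singleton, atHit] at this ⊢
    split_ifs
    · exact this
    · simp
  | succ n ih =>
    have hU : U.Nonempty := Finset.card_pos.1 (by omega)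
    by_cases hj : Y ∈ F ∧ j = 0
    · have h3 : ∀ h' : Finset α → List α → ℕ, ∀ l : List α, atHit F h' j Y l = h' Y l := by
        intro h' l
        cases l <;> simp [atHit, hj.1, hj.2]
      simp only [h3]
      exact h Y U hYU
    · obtain ⟨i, hi⟩ : ∃ i, ∀ h' : Finset α → List α → ℕ, ∀ x : α, ∀ l : List α,
          atHit F h' j Y (x :: l) = atHit F h' i (insert x Y) l := by
        by_cases hY : Y ∈ F
        · have hj0 : j ≠ 0 := fun h0 => hj ⟨hY, h0⟩
          exact ⟨j - 1, fun h' x l => by simp [atHit, hY, hj0]⟩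
        · exact ⟨j, fun h' x l => by simp [atHit, hY]⟩
      rw [sum_orders_cons hU, sum_orders_cons hU]
      simp only [hi]
      push_cast
      rw [Finset.mul_sum]
      refine Finset.sum_le_sum fun x hx => ?_
      have hd : Disjoint (insert x Y) (U.erase x) := by
        rw [Finset.disjoint_insert_left]
        exact ⟨by simp, hYU.mono_right (Finset.erase_subset _ _)⟩
      have := ih i (insert x Y) (U.erase x) hd (by rw [Finset.card_erase_of_mem hx]; omega)
      push_cast at this
      exact this

end Hits

/-! ### The entry after the (j + 1)-st hit is rarely bad -/

section Interleave

variable {α : Type*} [DecidableEq α]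

/-- Follow the first list from `Y`, but add the next entry of the second list whenever a member of
`F` is reached. -/
def interleave (F : Finset (Finset α)) : Finset α → List α → List α → List α
  | _, E, [] => E
  | _, [], e :: es => e :: es
  | Y, y :: E, e :: es =>
    if Y ∈ F then e :: interleave F (insert e Y) (y :: E) es
    else y :: interleave F (insert y Y) E (e :: es)
termination_by _ E es => E.length + es.length

theorem interleave_cons_of_mem {F : Finset (Finset α)} {Y : Finset α} (hY : Y ∈ F) (E : List α)
    (e : α) (es : List α) :
    interleave F Y E (e :: es) = e :: interleave F (insert e Y) E es := by
  cases E with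
  | nil => cases es <;> simp [interleave]
  | cons y E => rw [interleave, if_pos hY]

theorem interleave_cons_of_notMem {F : Finset (Finset α)} {Y : Finset α} (hY : Y ∉ F) (y : α)
    (E es : List α) :
    interleave F Y (y :: E) es = y :: interleave F (insert y Y) E es := by
  cases es with
  | nil => cases E <;> simp [interleave]
  | cons e es => rw [interleave, if_neg hY]

theorem interleave_perm (F : Finset (Finset α)) (Y : Finset α) (E es : List α) :
    (interleave F Y E es).Perm (E ++ es) := by
  induction hn : E.length + es.length generalizing Y E es with
  | zero =>
    have h1 : E = [] := List.length_eq_zero_iff.1 (by omega)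
    have h2 : es = [] := List.length_eq_zero_iff.1 (by omega)
    subst h1 h2
    simp [interleave]
  | succ n ih =>
    cases es with
    | nil => simp [interleave]
    | cons e es =>
      cases E with
      | nil => simp [interleave]
      | cons y E =>
        simp only [List.length_cons] at hn
        by_cases hY : Y ∈ F
        · rw [interleave_cons_of_mem hY]
          exact ((ih _ (y :: E) es (by simp only [List.length_cons]; omega)).cons e).trans
            List.perm_middle.symm
        · rw [interleave_cons_of_notMem hY]
          exact (ih _ E (e :: es) (by simp only [List.length_cons]; omega)).cons y

/-- The walk can be decoded: whether the current set lies in F tells which list supplied the next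
entry, and equal lengths make both walks exhaust their lists together. -/
theorem interleave_injective (F : Finset (Finset α)) (Y : Finset α) (E E' es es' : List α)
    (hE : E.length = E'.length) (hes : es.length = es'.length)
    (h : interleave F Y E es = interleave F Y E' es') : E = E' ∧ es = es' := by
  induction hn : E.length + es.length generalizing Y E E' es es' with
  | zero =>
    have h1 : E = [] := List.length_eq_zero_iff.1 (by omega)
    have h2 : es = [] := List.length_eq_zero_iff.1 (by omega)
    have h3 : E' = [] := List.length_eq_zero_iff.1 (by omega)
    have h4 : es' = [] := List.length_eq_zero_iff.1 (by omega)
    exact ⟨h1.trans h3.symm, h2.trans h4.symm⟩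
  | succ n ih =>
    cases es with
    | nil =>
      cases es' with
      | cons _ _ => simp at hes
      | nil => simpa [interleave] using h
    | cons e es =>
      cases es' with
      | nil => simp at hes
      | cons e' es' =>
        cases E with
        | nil =>
          cases E' with
          | cons _ _ => simp at hE
          | nil => simpa [interleave] using h
        | cons y E =>
          cases E' with
          | nil => simp at hE
          | cons y' E' =>
            simp only [List.length_cons] at hn hE hes
            by_cases hY : Y ∈ F
            · rw [interleave_cons_of_mem hY, interleave_cons_of_mem hY, List.cons.injEq] at h
              obtain ⟨rfl, h⟩ := h
              obtain ⟨h1, rfl⟩ := ih _ _ _ _ _ (by simp only [List.length_cons]; omega)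
                (by omega) h (by simp only [List.length_cons]; omega)
              exact ⟨h1, rfl⟩
            · rw [interleave_cons_of_notMem hY, interleave_cons_of_notMem hY,
                List.cons.injEq] at h
              obtain ⟨rfl, h⟩ := h
              obtain ⟨rfl, h2⟩ := ih _ _ _ _ _ (by omega)
                (by simp only [List.length_cons]; omega) h
                (by simp only [List.length_cons]; omega)
              exact ⟨rfl, h2⟩

theorem atHit_headBad_of_length_le (F : Finset (Finset α)) (j : ℕ) (Y : Finset α) (l : List α)
    (hl : l.length ≤ j) : atHit F (headBad F) j Y l = 0 := by
  induction l generalizing j Y with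
  | nil => simp [atHit, headBad]
  | cons x l ih =>
    rw [List.length_cons] at hl
    rw [atHit, if_neg (show j ≠ 0 by omega), ih (j - 1) _ (by omega), ih j _ (by omega), ite_self]

theorem atHit_interleave_singleton {F : Finset (Finset α)} {Y : Finset α} (hY : Y ∈ F)
    (E : List α) (x : α) :
    atHit F (headBad F) 0 Y (interleave F Y E [x]) = if Bad F Y x then 1 else 0 := by
  rw [interleave_cons_of_mem hY, atHit, if_pos hY, if_pos rfl, headBad]

theorem atHit_interleave_cons_of_mem {F : Finset (Finset α)} {Y : Finset α} (hY : Y ∈ F)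
    (E : List α) (e : α) (es : List α) (j : ℕ) :
    atHit F (headBad F) (j + 1) Y (interleave F Y E (e :: es)) =
      atHit F (headBad F) j (insert e Y) (interleave F (insert e Y) E es) := by
  rw [interleave_cons_of_mem hY, atHit, if_pos hY, if_neg (Nat.succ_ne_zero j),
    Nat.add_sub_cancel]

theorem atHit_interleave_of_notMem {F : Finset (Finset α)} {Y : Finset α} (hY : Y ∉ F) (y : α)
    (E es : List α) (j : ℕ) :
    atHit F (headBad F) j Y (interleave F Y (y :: E) es) =
      atHit F (headBad F) j (insert y Y) (interleave F (insert y Y) E es) := by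
  rw [interleave_cons_of_notMem hY, atHit, if_neg hY]

/-- One of the j + 1 entries is spent leaving Y, which is not a hit, so no entry is left to follow a
(j + 1)-st hit. -/
theorem atHit_interleave_nil {F : Finset (Finset α)} {Y : Finset α} (hY : Y ∉ F)
    (es : List α) (j : ℕ) (hj : es.length = j + 1) :
    atHit F (headBad F) j Y (interleave F Y [] es) = 0 := by
  cases es with
  | nil => simp at hj
  | cons e es =>
    rw [List.length_cons] at hj
    rw [interleave, atHit, if_neg hY]
    exact atHit_headBad_of_length_le _ _ _ _ (by omega)

/-- If the last entry of the second list is still bad when it is reached, then the first list meets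
`F`, and at that moment some entry of the second list is bad. -/
theorem exists_bad_of_atHit_interleave (F : Finset (Finset α)) (j : ℕ) (Y : Finset α)
    (E es : List α) (hj : es.length = j + 1)
    (h : atHit F (headBad F) j Y (interleave F Y E es) ≠ 0) :
    ∃ i : ℕ, Y ∪ (E.take i).toFinset ∈ F ∧ ∃ x ∈ es, Bad F (Y ∪ (E.take i).toFinset) x := by
  induction hn : E.length + es.length generalizing Y E es j with
  | zero => omega
  | succ n ih =>
    by_cases hY : Y ∈ F
    · refine ⟨0, by simpa using hY, ?_⟩
      cases es with
      | nil => simp at hj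
      | cons e es =>
        cases j with
        | zero =>
          have hes : es = [] := List.length_eq_zero_iff.1 (by simpa using hj)
          subst hes
          rw [atHit_interleave_singleton hY] at h
          refine ⟨e, by simp, ?_⟩
          by_contra hc
          rw [List.take_zero, List.toFinset_nil, Finset.union_empty] at hc
          exact h (if_neg hc)
        | succ j =>
          rw [atHit_interleave_cons_of_mem hY] at h
          simp only [List.length_cons] at hj hn
          obtain ⟨i, _, x, hx, hb⟩ := ih j _ E es (by omega) h (by omega)
          refine ⟨x, List.mem_cons_of_mem _ hx, hb.anti ?_⟩
          intro z hz
          simp only [List.take_zero, List.toFinset_nil, Finset.union_empty] at hz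
          exact Finset.mem_union_left _ (Finset.mem_insert_of_mem hz)
    · cases E with
      | nil => exact absurd (atHit_interleave_nil hY es j hj) h
      | cons y E =>
        rw [atHit_interleave_of_notMem hY] at h
        simp only [List.length_cons] at hn
        obtain ⟨i, h1, h2⟩ := ih j _ E es hj h (by omega)
        have he : Y ∪ ((y :: E).take (i + 1)).toFinset = insert y Y ∪ (E.take i).toFinset := by
          rw [List.take_succ_cons, List.toFinset_cons, Finset.union_insert, Finset.insert_union]
        exact ⟨i + 1, by rwa [he], by rwa [he]⟩

/-- Induction on j. At a member Y of F some choice a of the first inserted entry contributes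
nothing, and each of the other j + 1 choices contributes at most j! by induction, for a total of (j
+ 1)!. -/
theorem sum_atHit_interleave_le (F : Finset (Finset α)) (j : ℕ) (Y : Finset α) (E : List α)
    (ε : Finset α) (hε : ε.card = j + 1) :
    ∑ es ∈ orders ε, atHit F (headBad F) j Y (interleave F Y E es) ≤ j.factorial := by
  induction j generalizing Y E ε with
  | zero =>
    obtain ⟨x, rfl⟩ := Finset.card_eq_one.1 hε
    rw [sum_orders_cons (Finset.singleton_nonempty x)]
    simp only [Finset.sum_singleton, Finset.erase_singleton, orders_empty, Nat.factorial_zero]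
    induction E generalizing Y with
    | nil =>
      by_cases hY : Y ∈ F
      · rw [atHit_interleave_singleton hY]
        split_ifs <;> simp
      · rw [atHit_interleave_nil hY _ _ rfl]
        simp
    | cons y E ihE =>
      by_cases hY : Y ∈ F
      · rw [atHit_interleave_singleton hY]
        split_ifs <;> simp
      · rw [atHit_interleave_of_notMem hY]
        exact ihE _
  | succ j ih =>
    have hmem : ∀ (Y : Finset α) (E : List α), Y ∈ F →
        ∑ es ∈ orders ε, atHit F (headBad F) (j + 1) Y (interleave F Y E es) ≤
          (j + 1).factorial := by
      intro Y E hY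
      have hne : ε.Nonempty := Finset.card_pos.1 (by omega)
      obtain ⟨a, ha, hzero⟩ : ∃ a ∈ ε, ∀ es ∈ orders (ε.erase a),
          atHit F (headBad F) j (insert a Y) (interleave F (insert a Y) E es) = 0 := by
        -- Otherwise every a has a next member Y ∪ {a} ∪ E_i of F, with E_i the first i entries of
        -- E, for which some x in ε is bad.
        by_contra! hcon
        have hex : ∀ a ∈ ε, ∃ i : ℕ, insert a Y ∪ (E.take i).toFinset ∈ F ∧
            ∃ x ∈ ε, Bad F (insert a Y ∪ (E.take i).toFinset) x := by
          intro a ha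
          obtain ⟨es, hes, h⟩ := hcon a ha
          have hlen := length_of_mem_orders hes
          rw [Finset.card_erase_of_mem ha] at hlen
          obtain ⟨i, h1, x, hx, h2⟩ :=
            exists_bad_of_atHit_interleave F j _ E es (by omega) h
          refine ⟨i, h1, x, ?_, h2⟩
          rw [← List.mem_toFinset, (mem_orders.1 hes).2] at hx
          exact Finset.mem_of_mem_erase hx
        choose! i hi x hx hb using hex
        -- Take a with the longest prefix. The member found for x = x(a) uses a prefix no longer
        -- than that of a, so it contains x and lies in Y ∪ {a, x} ∪ E_i, contradicting that x is
        -- bad there.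
        obtain ⟨a, ha, hmax⟩ := Finset.exists_max_image ε i hne
        refine hb a ha _ (hi (x a) (hx a ha)) (by simp) ?_
        intro z hz
        simp only [Finset.mem_union, Finset.mem_insert, List.mem_toFinset] at hz ⊢
        rcases hz with (rfl | hz) | hz
        · exact Or.inl rfl
        · exact Or.inr (Or.inl (Or.inr hz))
        · exact Or.inr (Or.inr ((List.take_prefix_take_left (hmax _ (hx a ha))).subset hz))
      rw [sum_orders_cons hne]
      simp only [atHit_interleave_cons_of_mem hY]
      rw [← Finset.add_sum_erase _ _ ha, Finset.sum_eq_zero hzero, zero_add]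
      refine (Finset.sum_le_card_nsmul _ _ j.factorial fun b hb => ?_).trans ?_
      · have hb' := Finset.mem_of_mem_erase hb
        exact ih _ _ _ (by rw [Finset.card_erase_of_mem hb']; omega)
      · rw [Finset.card_erase_of_mem ha, hε, Nat.factorial_succ, smul_eq_mul]
        simp
    induction E generalizing Y with
    | nil =>
      by_cases hY : Y ∈ F
      · exact hmem Y _ hY
      · rw [Finset.sum_eq_zero fun es hes =>
          atHit_interleave_nil hY es (j + 1) (by rw [length_of_mem_orders hes, hε])]
        exact Nat.zero_le _
    | cons y E ihE =>
      by_cases hY : Y ∈ F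
      · exact hmem Y _ hY
      · simp only [atHit_interleave_of_notMem hY]
        exact ihE _

/-- On a random chain, the entry added right after the `(j + 1)`-st member of `F` is bad with
probability at most `1 / (j + 1)`. -/
theorem sum_atHit_headBad_le (F : Finset (Finset α)) (j : ℕ) (Y U : Finset α) :
    ((∑ l ∈ orders U, atHit F (headBad F) j Y l : ℕ) : ℝ) ≤
      1 / (j + 1) * U.card.factorial := by
  by_cases hU : U.card ≤ j
  · rw [Finset.sum_eq_zero fun l hl =>
      atHit_headBad_of_length_le F j Y l (by rw [length_of_mem_orders hl]; exact hU)]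
    rw [Nat.cast_zero]
    positivity
  -- Feed the last j + 1 entries of the order into its first d entries; this only permutes the set
  -- of all orders.
  · obtain ⟨d, hd⟩ : ∃ d, U.card = d + (j + 1) := ⟨U.card - (j + 1), by omega⟩
    have hcomp := sum_orders_comp (U := U)
      (fun l => interleave F Y (l.take d) (l.drop d))
      (fun l _ => by
        have := interleave_perm F Y (l.take d) (l.drop d)
        rwa [List.take_append_drop] at this)
      (fun l hl l' hl' h => by
        have h1 := length_of_mem_orders hl
        have h2 := length_of_mem_orders hl'
        obtain ⟨h3, h4⟩ := interleave_injective F Y _ _ _ _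
          (by simp only [List.length_take]; omega) (by simp only [List.length_drop]; omega) h
        rw [← List.take_append_drop d l, ← List.take_append_drop d l', h3, h4])
      (fun l => ((atHit F (headBad F) j Y l : ℕ) : ℝ))
    push_cast
    rw [← hcomp, hd]
    refine sum_orders_le_of_suffix (j + 1) (1 / (j + 1))
      (fun E es => ((atHit F (headBad F) j Y (interleave F Y E es) : ℕ) : ℝ)) ?_ d U hd
    intro E ε hε
    have := sum_atHit_interleave_le F j Y E ε hε
    have h' : (((∑ es ∈ orders ε, atHit F (headBad F) j Y (interleave F Y E es) : ℕ)) : ℝ) ≤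
        (j.factorial : ℝ) := by exact_mod_cast this
    push_cast at h'
    refine h'.trans (le_of_eq ?_)
    rw [Nat.factorial_succ]
    push_cast
    field_simp

end Interleave

/-! ### The window between two hits, complementation, and the bound on Λ -/

section Window

variable {α : Type*} [DecidableEq α]

theorem hitCount_append_singleton (F : Finset (Finset α)) (Y : Finset α) (l : List α) (x : α) :
    hitCount F Y (l ++ [x]) =
      hitCount F Y l + if insert x (Y ∪ l.toFinset) ∈ F then 1 else 0 := by
  induction l generalizing Y with
  | nil => simp [hitCount]
  | cons y l ih =>
    rw [List.cons_append, hitCount, ih, hitCount, List.toFinset_cons, Finset.union_insert,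
      Finset.insert_union, add_assoc]

theorem leaveEntries_append (F : Finset (Finset α)) (Y : Finset α) (l m : List α) :
    leaveEntries F Y (l ++ m) = leaveEntries F Y l ++ leaveEntries F (Y ∪ l.toFinset) m := by
  induction l generalizing Y with
  | nil => simp [leaveEntries]
  | cons y l ih =>
    rw [List.cons_append, leaveEntries, ih, leaveEntries, List.toFinset_cons, Finset.union_insert,
      Finset.insert_union]
    split_ifs <;> simp

theorem hitEntries_append (F : Finset (Finset α)) (Y : Finset α) (l m : List α) :
    hitEntries F Y (l ++ m) = hitEntries F Y l ++ hitEntries F (Y ∪ l.toFinset) m := by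
  induction l generalizing Y with
  | nil => simp [hitEntries]
  | cons y l ih =>
    rw [List.cons_append, hitEntries, ih, hitEntries, List.toFinset_cons, Finset.union_insert,
      Finset.insert_union]
    split_ifs <;> simp

theorem hitCount_pos_of_mem (F : Finset (Finset α)) (Y : Finset α) (l : List α)
    (h : Y ∪ l.toFinset ∈ F) : 0 < hitCount F Y l := by
  induction l generalizing Y with
  | nil =>
    have : Y ∈ F := by simpa using h
    simp [hitCount, this]
  | cons x l ih =>
    rw [hitCount]
    have := ih (insert x Y) (by
      rwa [List.toFinset_cons, Finset.union_insert, ← Finset.insert_union] at h)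
    omega

theorem atHit_append (F : Finset (Finset α)) (h : Finset α → List α → ℕ) (j : ℕ) (Y : Finset α)
    (l m : List α) (hmem : Y ∪ l.toFinset ∈ F) (hj : hitCount F Y l = j + 1) :
    atHit F h j Y (l ++ m) = h (Y ∪ l.toFinset) m := by
  induction l generalizing Y j with
  | nil =>
    have hY : Y ∈ F := by simpa using hmem
    have hj0 : j = 0 := by
      simp only [hitCount, if_pos hY] at hj
      omega
    subst hj0
    cases m <;> simp [atHit, hY]
  | cons x l ih =>
    have hmem' : insert x Y ∪ l.toFinset ∈ F := by
      rwa [List.toFinset_cons, Finset.union_insert, ← Finset.insert_union] at hmem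
    have hpos := hitCount_pos_of_mem F _ _ hmem'
    rw [List.toFinset_cons, Finset.union_insert, ← Finset.insert_union, List.cons_append, atHit]
    rw [hitCount] at hj
    by_cases hY : Y ∈ F
    · rw [if_pos hY] at hj
      rw [if_pos hY, if_neg (by omega)]
      exact ih _ _ hmem' (by omega)
    · rw [if_neg hY] at hj
      rw [if_neg hY]
      exact ih _ _ hmem' (by omega)

theorem exists_prefix_hitCount (F : Finset (Finset α)) (j : ℕ) (Y : Finset α) (l : List α)
    (h : j + 1 ≤ hitCount F Y l) :
    ∃ l₁ l₂, l = l₁ ++ l₂ ∧ Y ∪ l₁.toFinset ∈ F ∧ hitCount F Y l₁ = j + 1 := by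
  induction l generalizing Y j with
  | nil =>
    by_cases hY : Y ∈ F
    · refine ⟨[], [], rfl, by simpa using hY, ?_⟩
      simp only [hitCount, if_pos hY] at h ⊢
      omega
    · simp [hitCount, hY] at h
  | cons x l ih =>
    have he : ∀ l₁ : List α, Y ∪ (x :: l₁).toFinset = insert x Y ∪ l₁.toFinset := by
      intro l₁
      rw [List.toFinset_cons, Finset.union_insert, ← Finset.insert_union]
    rw [hitCount] at h
    by_cases hY : Y ∈ F
    · rw [if_pos hY] at h
      cases j with
      | zero =>
        exact ⟨[], x :: l, rfl, by simpa using hY, by simp [hitCount, hY]⟩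
      | succ j =>
        obtain ⟨l₁, l₂, rfl, h1, h2⟩ := ih j (insert x Y) (by omega)
        exact ⟨x :: l₁, l₂, rfl, by rwa [he], by rw [hitCount, if_pos hY, h2]; omega⟩
    · rw [if_neg hY] at h
      obtain ⟨l₁, l₂, rfl, h1, h2⟩ := ih j (insert x Y) (by omega)
      exact ⟨x :: l₁, l₂, rfl, by rwa [he], by rw [hitCount, if_neg hY, h2]; omega⟩

theorem exists_suffix_hitCount (F : Finset (Finset α)) (j : ℕ) (Y : Finset α) (l : List α)
    (h : j + 1 ≤ hitCount F Y l) :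
    ∃ l₁ l₂, l = l₁ ++ l₂ ∧ Y ∪ l₁.toFinset ∈ F ∧ hitCount F (Y ∪ l₁.toFinset) l₂ = j + 1 := by
  induction l generalizing Y with
  | nil =>
    by_cases hY : Y ∈ F
    · refine ⟨[], [], rfl, by simpa using hY, ?_⟩
      simp only [hitCount, if_pos hY, List.toFinset_nil, Finset.union_empty] at h ⊢
      omega
    · simp [hitCount, hY] at h
  | cons x l ih =>
    have he : ∀ l₁ : List α, Y ∪ (x :: l₁).toFinset = insert x Y ∪ l₁.toFinset := by
      intro l₁
      rw [List.toFinset_cons, Finset.union_insert, ← Finset.insert_union]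
    by_cases hl : j + 1 ≤ hitCount F (insert x Y) l
    · obtain ⟨l₁, l₂, rfl, h1, h2⟩ := ih _ hl
      exact ⟨x :: l₁, l₂, rfl, by rwa [he], by rwa [he]⟩
    · by_cases hY : Y ∈ F
      · refine ⟨[], x :: l, rfl, by simpa using hY, ?_⟩
        simp only [hitCount, if_pos hY, List.toFinset_nil, Finset.union_empty] at h ⊢
        omega
      · rw [hitCount, if_neg hY] at h
        omega

theorem disjoint_insert_of_nodup_cons {Y : Finset α} {x : α} {l : List α} (hn : (x :: l).Nodup)
    (hd : Disjoint Y (x :: l).toFinset) : Disjoint (insert x Y) l.toFinset := by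
  rw [List.toFinset_cons, Finset.disjoint_insert_right] at hd
  refine Finset.disjoint_insert_left.2 ⟨?_, hd.2⟩
  simpa using (List.nodup_cons.1 hn).1

variable [Fintype α]

/-- The family of the complements of the members of `F`. -/
def complFamily (F : Finset (Finset α)) : Finset (Finset α) := F.image compl

theorem mem_complFamily {F : Finset (Finset α)} {A : Finset α} :
    A ∈ complFamily F ↔ Aᶜ ∈ F := by
  rw [complFamily, Finset.mem_image]
  constructor
  · rintro ⟨B, hB, rfl⟩
    rwa [compl_compl]
  · intro h
    exact ⟨_, h, compl_compl A⟩

theorem compl_union_toFinset {Y : Finset α} {l : List α} (hd : Disjoint Y l.toFinset) :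
    ((Y ∪ l.toFinset)ᶜ ∪ l.toFinset)ᶜ = Y := by
  ext z
  have : z ∈ Y → z ∉ l.toFinset := fun hz => Finset.disjoint_left.1 hd hz
  simp only [Finset.mem_compl, Finset.mem_union]
  tauto

theorem hitCount_complFamily (F : Finset (Finset α)) (Y : Finset α) (l : List α) (hn : l.Nodup)
    (hd : Disjoint Y l.toFinset) :
    hitCount (complFamily F) (Y ∪ l.toFinset)ᶜ l.reverse = hitCount F Y l := by
  induction l generalizing Y with
  | nil => simp [hitCount, mem_complFamily]
  | cons x l ih =>
    have he : Y ∪ (x :: l).toFinset = insert x Y ∪ l.toFinset := by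
      rw [List.toFinset_cons, Finset.union_insert, ← Finset.insert_union]
    have hset : (insert x ((Y ∪ (x :: l).toFinset)ᶜ ∪ l.toFinset))ᶜ = Y := by
      conv_rhs => rw [← compl_union_toFinset hd]
      rw [List.toFinset_cons, Finset.union_insert]
      simp only [Finset.union_insert]
    have hd' := disjoint_insert_of_nodup_cons hn hd
    rw [List.reverse_cons, hitCount_append_singleton, List.toFinset_reverse, hitCount]
    simp only [mem_complFamily, hset]
    rw [he, ih _ (List.nodup_cons.1 hn).2 hd', add_comm]

/-- Adding x to reach a member A of F becomes, on the reversed complementary chain, adding x to Aᶜ.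
-/
theorem leaveEntries_complFamily (F : Finset (Finset α)) (Y : Finset α) (l : List α)
    (hn : l.Nodup) (hd : Disjoint Y l.toFinset) :
    leaveEntries (complFamily F) (Y ∪ l.toFinset)ᶜ l.reverse = (hitEntries F Y l).reverse := by
  induction l generalizing Y with
  | nil => simp [leaveEntries, hitEntries]
  | cons x l ih =>
    have he : Y ∪ (x :: l).toFinset = insert x Y ∪ l.toFinset := by
      rw [List.toFinset_cons, Finset.union_insert, ← Finset.insert_union]
    have hd' := disjoint_insert_of_nodup_cons hn hd
    rw [List.reverse_cons, leaveEntries_append, List.toFinset_reverse, he,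
      ih _ (List.nodup_cons.1 hn).2 hd', hitEntries, leaveEntries]
    simp only [mem_complFamily, compl_union_toFinset hd']
    split_ifs <;> simp [leaveEntries]

/-- `F` has at most `r` elements between `P` and `Q` that are good both for `P` in `F` and, after
complementation, for `Q`. -/
def FewGood (F : Finset (Finset α)) (r : ℕ) : Prop :=
  ∀ P Q X : Finset α, P ⊆ Q → X ⊆ Q \ P →
    (∀ x ∈ X, ¬ Bad F P x ∧ ¬ Bad (complFamily F) Qᶜ x) → X.card ≤ r

/-- The chain has j + 1 hits up to P, j after Q, and one for each entry between them that leads into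
F. Each such entry is bad at P, bad at Q in the complement, or one of at most r good ones. -/
theorem hitCount_le_of_fewGood {F : Finset (Finset α)} {r : ℕ} (hF : FewGood F r) (j : ℕ)
    {Y U : Finset α} (hYU : Disjoint Y U) {l : List α} (hl : l ∈ orders U) :
    hitCount F Y l ≤ r + (2 * j + 1) + atHit F (badCount F (hitEntries F)) j Y l +
      atHit (complFamily F) (badCount (complFamily F) (leaveEntries (complFamily F))) j
        (Y ∪ U)ᶜ l.reverse := by
  obtain ⟨hn, rfl⟩ := mem_orders.1 hl
  by_cases hN : hitCount F Y l ≤ 2 * j + 1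
  · omega
  obtain ⟨l₁, l', rfl, hP, h1⟩ := exists_prefix_hitCount F j Y l (by omega)
  have hN1 : hitCount F Y (l₁ ++ l') =
      j + 1 + (hitEntries F (Y ∪ l₁.toFinset) l').length := by
    rw [hitCount_eq, hitEntries_append, List.length_append, ← add_assoc, ← hitCount_eq, h1]
  have hN2 := hitCount_eq F (Y ∪ l₁.toFinset) l'
  rw [if_pos hP] at hN2
  obtain ⟨l₂, l₃, rfl, hQ, h2⟩ := exists_suffix_hitCount F j (Y ∪ l₁.toFinset) l' (by omega)
  rw [atHit_append F _ j Y l₁ _ hP h1]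
  have hYl : Disjoint Y (l₁.toFinset ∪ (l₂.toFinset ∪ l₃.toFinset)) := by
    simpa only [List.toFinset_append] using hYU
  obtain ⟨hn1, hn23, hd1⟩ := List.nodup_append.1 hn
  obtain ⟨hn2, hn3, hd2⟩ := List.nodup_append.1 hn23
  set P := Y ∪ l₁.toFinset with hPdef
  set Q := P ∪ l₂.toFinset with hQdef
  have hPl : Disjoint P l₂.toFinset := by
    rw [Finset.disjoint_left]
    intro z hz hz2
    rcases Finset.mem_union.1 hz with hz | hz
    · exact Finset.disjoint_left.1 hYl hz (by simp [List.mem_toFinset.1 hz2])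
    · exact hd1 _ (List.mem_toFinset.1 hz) _
        (List.mem_append_left _ (List.mem_toFinset.1 hz2)) rfl
  have hQl : Disjoint Q l₃.toFinset := by
    rw [Finset.disjoint_left]
    intro z hz hz3
    rw [List.mem_toFinset] at hz3
    rcases Finset.mem_union.1 hz with hz | hz
    · rcases Finset.mem_union.1 hz with hz | hz
      · exact Finset.disjoint_left.1 hYl hz (by simp [hz3])
      · exact hd1 _ (List.mem_toFinset.1 hz) _ (List.mem_append_right _ hz3) rfl
    · exact hd2 _ (List.mem_toFinset.1 hz) _ hz3 rfl
  have hbase : Y ∪ (l₁ ++ (l₂ ++ l₃)).toFinset = Q ∪ l₃.toFinset := by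
    simp only [hQdef, hPdef, List.toFinset_append, Finset.union_assoc]
  have hQc : (Q ∪ l₃.toFinset)ᶜ ∪ l₃.reverse.toFinset = Qᶜ := by
    rw [List.toFinset_reverse, ← compl_compl ((Q ∪ l₃.toFinset)ᶜ ∪ l₃.toFinset),
      compl_union_toFinset hQl]
  have hrev : (l₁ ++ (l₂ ++ l₃)).reverse = l₃.reverse ++ (l₂.reverse ++ l₁.reverse) := by
    simp
  rw [hbase, hrev, atHit_append _ _ j _ l₃.reverse _
    (by rw [hQc, mem_complFamily, compl_compl]; exact hQ)
    (by rw [hitCount_complFamily F Q l₃ hn3 hQl, h2]), hQc]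
  have hB : ((hitEntries F P l₂).filter fun x => Bad F P x).length ≤
      badCount F (hitEntries F) P (l₂ ++ l₃) := by
    rw [badCount, hitEntries_append, List.filter_append, List.length_append]
    omega
  have hA : ((hitEntries F P l₂).filter fun x => Bad (complFamily F) Qᶜ x).length ≤
      badCount (complFamily F) (leaveEntries (complFamily F)) Qᶜ (l₂.reverse ++ l₁.reverse) := by
    rw [badCount, leaveEntries_append, List.filter_append, List.length_append, hQdef,
      leaveEntries_complFamily F P l₂ hn2 hPl, List.filter_reverse, List.length_reverse]
    omega
  have hKn : (hitEntries F P l₂).Nodup := (hitEntries_sublist F P l₂).nodup hn2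
  have hG : ((hitEntries F P l₂).filter
      fun x => ¬ Bad F P x ∧ ¬ Bad (complFamily F) Qᶜ x).length ≤ r := by
    rw [← List.toFinset_card_of_nodup (hKn.filter _)]
    refine hF P Q _ Finset.subset_union_left ?_ ?_
    · intro x hx
      rw [List.mem_toFinset, List.mem_filter] at hx
      have hx2 : x ∈ l₂.toFinset :=
        List.mem_toFinset.2 ((hitEntries_sublist F P l₂).subset hx.1)
      exact Finset.mem_sdiff.2 ⟨Finset.mem_union_right _ hx2,
        fun hxP => Finset.disjoint_left.1 hPl hxP hx2⟩
    · intro x hx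
      rw [List.mem_toFinset, List.mem_filter] at hx
      simpa using hx.2
  have hsplit : ∀ K : List α, K.length ≤ (K.filter fun x => Bad F P x).length +
      (K.filter fun x => Bad (complFamily F) Qᶜ x).length +
      (K.filter fun x => ¬ Bad F P x ∧ ¬ Bad (complFamily F) Qᶜ x).length := by
    intro K
    induction K with
    | nil => simp
    | cons x K ih =>
      by_cases c1 : Bad F P x <;> by_cases c2 : Bad (complFamily F) Qᶜ x <;>
        simp only [List.filter_cons, c1, c2, List.length_cons, decide_true, decide_false,
          not_true_eq_false, not_false_eq_true, and_true, and_false, and_self, if_true,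
          Bool.false_eq_true, if_false] <;> omega
  have hN3 := hitCount_eq F Q l₃
  rw [if_pos hQ, h2] at hN3
  rw [hitEntries_append, List.length_append, ← hQdef] at hN1
  have hK := hsplit (hitEntries F P l₂)
  omega

/-- A family with few good elements has small mass on every interval. -/
theorem sum_hitCount_le_of_fewGood {F : Finset (Finset α)} {r : ℕ} (hF : FewGood F r)
    {Y U : Finset α} (hYU : Disjoint Y U) :
    ((∑ l ∈ orders U, hitCount F Y l : ℕ) : ℝ) ≤ (2 * r + 14) * U.card.factorial := by
  -- All intervals are needed, since moving an element to the front passes to a smaller interval.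
  let pairs : Finset (Finset α × Finset α) := Finset.univ.filter fun p => Disjoint p.1 p.2
  let mass : Finset α × Finset α → ℝ :=
    fun p => ((∑ l ∈ orders p.2, hitCount F p.1 l : ℕ) : ℝ) / p.2.card.factorial
  obtain ⟨⟨Y₀, U₀⟩, hp₀, hmax⟩ := Finset.exists_max_image pairs mass
    ⟨(Y, U), by simpa [pairs] using hYU⟩
  have hd₀ : Disjoint Y₀ U₀ := by simpa [pairs] using hp₀
  set Λ : ℝ := mass (Y₀, U₀) with hΛdef
  have hfac : ∀ V : Finset α, (0 : ℝ) < V.card.factorial := fun V => by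
    exact_mod_cast Nat.factorial_pos _
  have hle : ∀ Y U : Finset α, Disjoint Y U →
      ((∑ l ∈ orders U, hitCount F Y l : ℕ) : ℝ) ≤ Λ * U.card.factorial := by
    intro Y U h
    have := hmax (Y, U) (by simpa [pairs] using h)
    exact (div_le_iff₀ (hfac U)).1 this
  have hle' : ∀ Y U : Finset α, Disjoint Y U →
      ((∑ l ∈ orders U, hitCount (complFamily F) Y l : ℕ) : ℝ) ≤ Λ * U.card.factorial := by
    intro Y U h
    have hd : Disjoint (Y ∪ U)ᶜ U := by
      rw [Finset.disjoint_left]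
      intro z hz hzU
      exact (Finset.mem_compl.1 hz) (Finset.mem_union_right _ hzU)
    have hrev : ∑ l ∈ orders U, hitCount (complFamily F) Y l =
        ∑ l ∈ orders U, hitCount F (Y ∪ U)ᶜ l := by
      rw [← sum_orders_reverse U (hitCount (complFamily F) Y)]
      refine Finset.sum_congr rfl fun l hl => ?_
      obtain ⟨hn, rfl⟩ := mem_orders.1 hl
      have hY : ((Y ∪ l.toFinset)ᶜ ∪ l.toFinset)ᶜ = Y := compl_union_toFinset h
      have := hitCount_complFamily F _ l hn hd
      rwa [hY] at this
    rw [hrev]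
    exact hle _ _ hd
  have hΛ : 0 ≤ Λ := by
    rw [hΛdef]
    positivity
  have hB : ((∑ l ∈ orders U₀, atHit F (badCount F (hitEntries F)) 3 Y₀ l : ℕ) : ℝ) ≤
      Λ * (1 / 4 * U₀.card.factorial) := by
    refine (sum_atHit_le F _ (headBad F) Λ ?_ 3 Y₀ U₀ hd₀).trans ?_
    · intro Y U h
      refine sum_badCount_le F _ (hitEntries_sublist F) Λ Y U fun x hx => ?_
      rw [sum_mem_hitEntries F Y U x hx, ← Finset.card_erase_of_mem hx]
      exact hle _ _ (Finset.disjoint_insert_left.2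
        ⟨by simp, h.mono_right (Finset.erase_subset _ _)⟩)
    · refine mul_le_mul_of_nonneg_left ((sum_atHit_headBad_le F 3 Y₀ U₀).trans ?_) hΛ
      norm_num
  have hdc : Disjoint (Y₀ ∪ U₀)ᶜ U₀ := by
    rw [Finset.disjoint_left]
    intro z hz hzU
    exact (Finset.mem_compl.1 hz) (Finset.mem_union_right _ hzU)
  have hA : ((∑ l ∈ orders U₀, atHit (complFamily F)
      (badCount (complFamily F) (leaveEntries (complFamily F))) 3 (Y₀ ∪ U₀)ᶜ l : ℕ) : ℝ) ≤
      Λ * (1 / 4 * U₀.card.factorial) := by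
    refine (sum_atHit_le _ _ (headBad (complFamily F)) Λ ?_ 3 _ U₀ hdc).trans ?_
    · intro Y U h
      refine sum_badCount_le _ _ (leaveEntries_sublist _) Λ Y U fun x hx => ?_
      rw [sum_mem_leaveEntries _ Y U x hx, ← Finset.card_erase_of_mem hx]
      exact hle' _ _ (h.mono_right (Finset.erase_subset _ _))
    · refine mul_le_mul_of_nonneg_left ((sum_atHit_headBad_le _ 3 _ U₀).trans ?_) hΛ
      norm_num
  have hsum : ∑ l ∈ orders U₀, hitCount F Y₀ l ≤ ∑ l ∈ orders U₀, (r + (2 * 3 + 1)) +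
      ∑ l ∈ orders U₀, atHit F (badCount F (hitEntries F)) 3 Y₀ l +
      ∑ l ∈ orders U₀, atHit (complFamily F)
        (badCount (complFamily F) (leaveEntries (complFamily F))) 3 (Y₀ ∪ U₀)ᶜ l := by
    rw [← sum_orders_reverse U₀ (atHit (complFamily F)
        (badCount (complFamily F) (leaveEntries (complFamily F))) 3 (Y₀ ∪ U₀)ᶜ),
      ← Finset.sum_add_distrib, ← Finset.sum_add_distrib]
    exact Finset.sum_le_sum fun l hl => hitCount_le_of_fewGood hF 3 hd₀ hl
  have hsumR : Λ * U₀.card.factorial ≤ (r + 7) * U₀.card.factorial +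
      Λ * (1 / 4 * U₀.card.factorial) + Λ * (1 / 4 * U₀.card.factorial) := by
    have h1 : Λ * U₀.card.factorial = ((∑ l ∈ orders U₀, hitCount F Y₀ l : ℕ) : ℝ) :=
      div_mul_cancel₀ _ (hfac U₀).ne'
    have h2 : ((∑ l ∈ orders U₀, (r + (2 * 3 + 1)) : ℕ) : ℝ) =
        (r + 7) * U₀.card.factorial := by
      rw [Finset.sum_const, card_orders, smul_eq_mul]
      push_cast
      ring
    have h3 := (Nat.cast_le (α := ℝ)).2 hsum
    rw [Nat.cast_add, Nat.cast_add, h2] at h3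
    rw [h1]
    linarith
  have hfin : Λ ≤ 2 * r + 14 := by
    have h0 := hfac U₀
    by_contra! hcon
    nlinarith
  exact (hle Y U hYU).trans (mul_le_mul_of_nonneg_right hfin (hfac U).le)

end Window

/-! ### Lubell mass as an average of hit counts -/

section Lubell

variable {α : Type*} [DecidableEq α]

theorem hitCount_eq_sum (F : Finset (Finset α)) (Y : Finset α) (l : List α) :
    hitCount F Y l = ∑ A ∈ F, hitCount {A} Y l := by
  induction l generalizing Y with
  | nil => simp [hitCount]
  | cons x l ih =>
    simp only [hitCount, Finset.mem_singleton, Finset.sum_add_distrib, ← ih]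
    simp

theorem hitCount_singleton_of_not_subset {A Y : Finset α} (h : ¬ Y ⊆ A) (l : List α) :
    hitCount {A} Y l = 0 := by
  induction l generalizing Y with
  | nil =>
    have : Y ≠ A := fun he => h he.subset
    simp [hitCount, this]
  | cons x l ih =>
    have : Y ≠ A := fun he => h he.subset
    rw [hitCount, ih fun hs => h ((Finset.subset_insert _ _).trans hs)]
    simp [this]

/-- The number of maximal chains of an interval through a given set. -/
theorem sum_hitCount_singleton (A Y U : Finset α) (hYU : Disjoint Y U) (hYA : Y ⊆ A)
    (hA : A ⊆ Y ∪ U) :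
    ∑ l ∈ orders U, hitCount {A} Y l =
      (A \ Y).card.factorial * (U.card - (A \ Y).card).factorial := by
  induction hn : U.card generalizing U Y with
  | zero =>
    rw [Finset.card_eq_zero] at hn
    subst hn
    rw [Finset.union_empty] at hA
    have : Y = A := hYA.antisymm hA
    subst this
    simp [orders_empty, hitCount]
  | succ n ih =>
    have hU : U.Nonempty := Finset.card_pos.1 (by omega)
    rw [sum_orders_cons hU]
    by_cases hYeq : Y = A
    · subst hYeq
      have h1 : ∀ x ∈ U, ∑ l ∈ orders (U.erase x), hitCount {Y} Y (x :: l) = n.factorial := by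
        intro x hx
        have hxY : x ∉ Y := fun h => Finset.disjoint_left.1 hYU h hx
        have h2 : ∀ l : List α, hitCount {Y} Y (x :: l) = 1 := by
          intro l
          rw [hitCount, hitCount_singleton_of_not_subset]
          · simp
          · intro hs
            exact hxY (hs (Finset.mem_insert_self _ _))
        simp only [h2, Finset.sum_const, card_orders, Finset.card_erase_of_mem hx, hn]
        simp
      rw [Finset.sum_congr rfl h1, Finset.sum_const, hn]
      simp [Nat.factorial_succ]
    · have hAU : A \ Y ⊆ U := by
        intro z hz
        obtain ⟨hz1, hz2⟩ := Finset.mem_sdiff.1 hz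
        exact (Finset.mem_union.1 (hA hz1)).resolve_left hz2
      obtain ⟨a, ha⟩ : ∃ a, (A \ Y).card = a + 1 := by
        refine ⟨(A \ Y).card - 1, ?_⟩
        have : (A \ Y).card ≠ 0 := by
          intro h
          rw [Finset.card_eq_zero, Finset.sdiff_eq_empty_iff_subset] at h
          exact hYeq (hYA.antisymm h)
        omega
      have h1 : ∀ x ∈ U, x ∉ A \ Y →
          ∑ l ∈ orders (U.erase x), hitCount {A} Y (x :: l) = 0 := by
        intro x hx hxA
        have hxA' : x ∉ A := fun h =>
          hxA (Finset.mem_sdiff.2 ⟨h, fun hY => Finset.disjoint_left.1 hYU hY hx⟩)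
        refine Finset.sum_eq_zero fun l _ => ?_
        rw [hitCount, hitCount_singleton_of_not_subset]
        · simp [hYeq]
        · intro hs
          exact hxA' (hs (Finset.mem_insert_self _ _))
      have h2 : ∀ x ∈ A \ Y, ∑ l ∈ orders (U.erase x), hitCount {A} Y (x :: l) =
          a.factorial * (n - a).factorial := by
        intro x hx
        obtain ⟨hxA, hxY⟩ := Finset.mem_sdiff.1 hx
        have hxU := hAU hx
        have hcard : (A \ insert x Y).card = a := by
          rw [Finset.sdiff_insert, Finset.card_erase_of_mem hx, ha]
          rfl
        rw [← hcard]
        rw [← ih (insert x Y) (U.erase x)]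
        · refine Finset.sum_congr rfl fun l _ => ?_
          rw [hitCount]
          simp [hYeq]
        · exact Finset.disjoint_insert_left.2
            ⟨by simp, hYU.mono_right (Finset.erase_subset _ _)⟩
        · exact Finset.insert_subset hxA hYA
        · intro z hz
          have := hA hz
          simp only [Finset.mem_union, Finset.mem_insert, Finset.mem_erase] at this ⊢
          tauto
        · rw [Finset.card_erase_of_mem hxU]
          omega
      rw [← Finset.sum_subset hAU h1, Finset.sum_congr rfl h2, Finset.sum_const, ha,
        Nat.factorial_succ, smul_eq_mul, mul_assoc, Nat.add_sub_add_right]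

theorem lubell_eq_sum_hitCount {n : ℕ} (F : Finset (Finset (Fin n))) :
    lubell F * n.factorial = ((∑ l ∈ orders Finset.univ, hitCount F ∅ l : ℕ) : ℝ) := by
  simp only [hitCount_eq_sum F]
  rw [Finset.sum_comm, lubell_eq_sum, Finset.sum_mul]
  push_cast
  refine Finset.sum_congr rfl fun A _ => ?_
  have h := sum_hitCount_singleton A ∅ Finset.univ (Finset.disjoint_empty_left _)
    (Finset.empty_subset _) (by simp)
  have hA : A.card ≤ n := by simpa using A.card_le_univ
  have h' := (Nat.cast_inj (R := ℝ)).2 h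
  push_cast at h'
  rw [h', Finset.sdiff_empty, Finset.card_univ, Fintype.card_fin, Nat.cast_choose ℝ hA]
  field_simp

end Lubell

/-! ### Standard examples from good elements, and their absence from few levels -/

section StandardExample

/-- The sets B_x ⊆ P ∪ {x} and A_x ⊇ Q \ {x} witnessing goodness form the copy: for x ≠ y, B_y ⊆ P ∪
{y} ⊆ Q lies in A_x because x ∉ B_y, while x itself separates B_x from A_x. -/
theorem containsCopy_of_good {n r : ℕ} {F : Finset (Finset (Fin n))} {P Q X : Finset (Fin n)}
    (hPQ : P ⊆ Q) (hX : X ⊆ Q \ P)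
    (hgood : ∀ x ∈ X, ¬ Bad F P x ∧ ¬ Bad (complFamily F) Qᶜ x) (hr : r < X.card) :
    ContainsCopy (StdEx r) F := by
  have hB : ∀ x ∈ X, ∃ B ∈ F, x ∈ B ∧ B ⊆ insert x P := by
    intro x hx
    have := (hgood x hx).1
    unfold Bad at this
    push Not at this
    exact this
  have hA : ∀ x ∈ X, ∃ A ∈ F, x ∉ A ∧ Q.erase x ⊆ A := by
    intro x hx
    have := (hgood x hx).2
    unfold Bad at this
    push Not at this
    obtain ⟨A, hA, hxA, hs⟩ := this
    refine ⟨Aᶜ, mem_complFamily.1 hA, by simpa using hxA, ?_⟩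
    intro z hz
    rw [Finset.mem_compl]
    intro hzA
    obtain ⟨hz1, hz2⟩ := Finset.mem_erase.1 hz
    rcases Finset.mem_insert.1 (hs hzA) with h | h
    · exact hz1 h
    · exact Finset.mem_compl.1 h hz2
  choose! B hBF hxB hBP using hB
  choose! A hAF hxA hQA using hA
  -- One element beyond r is kept as a spare: it lies in every chosen A and in no chosen B, which
  -- rules out A ⊆ B even for small r.
  obtain ⟨X', hX', hcard⟩ := Finset.exists_subset_card_eq (Nat.succ_le_of_lt hr)
  let e : Fin (r + 1) ≃ X' := (finCongr hcard.symm).trans X'.equivFin.symm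
  let x : Fin (r + 1) → Fin n := fun i => (e i : Fin n)
  have hx : ∀ i, x i ∈ X := fun i => hX' (e i).2
  have hinj : Function.Injective x := fun i j h => e.injective (Subtype.ext h)
  have hxQ : ∀ i, x i ∈ Q := fun i => (Finset.mem_sdiff.1 (hX (hx i))).1
  have hxP : ∀ i, x i ∉ P := fun i => (Finset.mem_sdiff.1 (hX (hx i))).2
  have hAmem : ∀ i j, i ≠ j → x j ∈ A (x i) := fun i j hij =>
    hQA _ (hx i) (Finset.mem_erase.2 ⟨fun h => hij (hinj h).symm, hxQ j⟩)
  have hBmem : ∀ i j, i ≠ j → x j ∉ B (x i) := by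
    intro i j hij h
    rcases Finset.mem_insert.1 (hBP _ (hx i) h) with h | h
    · exact hij (hinj h).symm
    · exact hxP j h
  have hBA : ∀ i j, i ≠ j → B (x j) ⊆ A (x i) := by
    intro i j hij z hz
    rcases Finset.mem_insert.1 (hBP _ (hx j) hz) with rfl | h
    · exact hAmem i j hij
    · exact hQA _ (hx i) (Finset.mem_erase.2 ⟨fun h' => hxP i (h' ▸ h), hPQ h⟩)
  let f : StdEx r → {S : Finset (Fin n) // S ∈ F} := fun p =>
    match p with
    | .a i => ⟨A (x i.castSucc), hAF _ (hx _)⟩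
    | .b i => ⟨B (x i.castSucc), hBF _ (hx _)⟩
  have hcs : ∀ i j : Fin r, i ≠ j → i.castSucc ≠ j.castSucc := fun i j hij h =>
    hij (Fin.castSucc_injective _ h)
  have hle : ∀ p q : StdEx r, f p ≤ f q ↔ p ≤ q := by
    intro p q
    cases p with
    | a i =>
      cases q with
      | a j =>
        change A (x i.castSucc) ⊆ A (x j.castSucc) ↔ i = j
        constructor
        · intro h
          by_contra hij
          exact hxA _ (hx _) (h (hAmem _ _ (hcs i j hij)))
        · rintro rfl
          exact subset_rfl
      | b j =>
        change A (x i.castSucc) ⊆ B (x j.castSucc) ↔ False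
        rw [iff_false]
        intro h
        exact hBmem _ (Fin.last r) (Fin.castSucc_lt_last j).ne
          (h (hAmem _ (Fin.last r) (Fin.castSucc_lt_last i).ne))
    | b i =>
      cases q with
      | a j =>
        change B (x i.castSucc) ⊆ A (x j.castSucc) ↔ j ≠ i
        constructor
        · rintro h rfl
          exact hxA _ (hx _) (h (hxB _ (hx _)))
        · intro hij
          exact hBA _ _ (hcs j i hij)
      | b j =>
        change B (x i.castSucc) ⊆ B (x j.castSucc) ↔ i = j
        constructor
        · intro h
          by_contra hij
          exact hBmem _ _ (hcs j i (Ne.symm hij)) (h (hxB _ (hx _)))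
        · rintro rfl
          exact subset_rfl
  exact ⟨OrderEmbedding.ofMapLEIff f hle⟩

/-- The Lubell mass of an `S_r`-free family is at most `2 r + 14`. -/
theorem lubell_le_of_posetFree {n r : ℕ} {F : Finset (Finset (Fin n))}
    (hF : PosetFree (StdEx r) F) : lubell F ≤ 2 * r + 14 := by
  have hfew : FewGood F r := by
    intro P Q X hPQ hX hgood
    by_contra! hr
    exact hF (containsCopy_of_good hPQ hX hgood hr)
  have h := sum_hitCount_le_of_fewGood hfew (Finset.disjoint_empty_left Finset.univ)
  rw [← lubell_eq_sum_hitCount, Finset.card_univ, Fintype.card_fin] at h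
  exact le_of_mul_le_mul_right h (by exact_mod_cast Nat.factorial_pos n)

/-- Pick x_j in B_j \ A_j. These are distinct, and A_0 contains B_1 together with the r - 2 points
x_j for j ≠ 0, 1, none of which is in B_1. So the sizes of A_0 and B_1 differ by at least r - 2. -/
theorem posetFree_levels {r : ℕ} (hr : 2 ≤ r) (n k : ℕ) :
    PosetFree (StdEx r) (levels n k (r - 2)) := by
  rintro ⟨f⟩
  let A : Fin r → Finset (Fin n) := fun i => (f (.a i)).1
  let B : Fin r → Finset (Fin n) := fun i => (f (.b i)).1
  have hBA : ∀ i j : Fin r, B j ⊆ A i ↔ i ≠ j := fun i j =>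
    f.le_iff_le (a := .b j) (b := .a i)
  have hx : ∀ j, ∃ x ∈ B j, x ∉ A j := by
    intro j
    have : ¬ B j ⊆ A j := by rw [hBA]; simp
    exact Finset.not_subset.1 this
  choose x hxB hxA using hx
  have hinj : Function.Injective x := by
    intro i j h
    by_contra hij
    exact hxA i (h ▸ (hBA i j).2 hij (hxB j))
  let i₀ : Fin r := ⟨0, by omega⟩
  let i₁ : Fin r := ⟨1, by omega⟩
  have h01 : i₀ ≠ i₁ := by simp [i₀, i₁]
  let I : Finset (Fin r) := (Finset.univ.erase i₀).erase i₁
  have hI : I.card = r - 2 := by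
    rw [Finset.card_erase_of_mem (Finset.mem_erase.2 ⟨h01.symm, Finset.mem_univ _⟩),
      Finset.card_erase_of_mem (Finset.mem_univ _), Finset.card_univ, Fintype.card_fin]
    omega
  have hdisj : Disjoint (B i₁) (I.image x) := by
    rw [Finset.disjoint_right]
    intro z hz hzB
    obtain ⟨j, hj, rfl⟩ := Finset.mem_image.1 hz
    exact hxA j ((hBA j i₁).2 (Finset.ne_of_mem_erase hj) hzB)
  have hsub : B i₁ ∪ I.image x ⊆ A i₀ := by
    refine Finset.union_subset ((hBA i₀ i₁).2 h01) ?_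
    intro z hz
    obtain ⟨j, hj, rfl⟩ := Finset.mem_image.1 hz
    exact (hBA i₀ j).2 (Finset.ne_of_mem_erase (Finset.mem_of_mem_erase hj)).symm (hxB j)
  have hcard := Finset.card_le_card hsub
  rw [Finset.card_union_of_disjoint hdisj, Finset.card_image_of_injective _ hinj, hI] at hcard
  have h1 : k ≤ (B i₁).card ∧ (B i₁).card < k + (r - 2) :=
    (Finset.mem_filter.1 (f (.b i₁)).2).2
  have h2 : k ≤ (A i₀).card ∧ (A i₀).card < k + (r - 2) :=
    (Finset.mem_filter.1 (f (.a i₀)).2).2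
  omega

end StandardExample

/-! ### Asymptotic size of the middle levels -/

section MiddleLevels

theorem tendsto_choose_half_add_div (d : ℕ) :
    Tendsto (fun n : ℕ => (n.choose (n / 2 + d) : ℝ) / (n.choose (n / 2) : ℝ)) atTop (𝓝 1) := by
  have hq : Tendsto (fun n : ℕ => ((n / 2 : ℕ) : ℝ)) atTop atTop :=
    tendsto_natCast_atTop_atTop.comp (Nat.tendsto_div_const_atTop (by norm_num))
  have hpos : ∀ n : ℕ, (0 : ℝ) < n.choose (n / 2) := fun n => by
    exact_mod_cast Nat.choose_pos (Nat.div_le_self n 2)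
  induction d with
  | zero =>
    refine tendsto_const_nhds.congr fun n => ?_
    rw [add_zero, div_self (hpos n).ne']
  | succ d ih =>
    have hlim : ∀ c : ℝ, Tendsto (fun n : ℕ => 1 + c / (((n / 2 : ℕ) : ℝ) + d + 1)) atTop
        (𝓝 1) := by
      intro c
      have h1 : Tendsto (fun n : ℕ => ((n / 2 : ℕ) : ℝ) + d + 1) atTop atTop := by
        simpa only [add_assoc] using tendsto_atTop_add_const_right atTop ((d : ℝ) + 1) hq
      simpa using (tendsto_const_nhds (x := (1 : ℝ))).add (h1.const_div_atTop c)
    have hratio : Tendsto (fun n : ℕ => ((n : ℝ) - ((n / 2 : ℕ) : ℝ) - d) /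
        (((n / 2 : ℕ) : ℝ) + d + 1)) atTop (𝓝 1) := by
      -- With q = ⌊n/2⌋ the ratio is 1 + (n - 2q - 2d - 1) / (q + d + 1), and n - 2q is 0 or 1.
      refine tendsto_of_tendsto_of_tendsto_of_le_of_le (hlim (-(2 * d + 1))) (hlim (-(2 * d)))
        (fun n => ?_) (fun n => ?_)
      · have hp : (0 : ℝ) < ((n / 2 : ℕ) : ℝ) + d + 1 := by positivity
        have h2 : (2 : ℝ) * ((n / 2 : ℕ) : ℝ) ≤ n := by exact_mod_cast Nat.mul_div_le n 2
        rw [← sub_nonneg]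
        have : ((n : ℝ) - ((n / 2 : ℕ) : ℝ) - d) / (((n / 2 : ℕ) : ℝ) + d + 1) -
            (1 + -(2 * d + 1) / (((n / 2 : ℕ) : ℝ) + d + 1)) =
            (n - 2 * ((n / 2 : ℕ) : ℝ)) / (((n / 2 : ℕ) : ℝ) + d + 1) := by
          field_simp
          ring
        rw [this]
        exact div_nonneg (by linarith) hp.le
      · have hp : (0 : ℝ) < ((n / 2 : ℕ) : ℝ) + d + 1 := by positivity
        have h2 : (n : ℝ) ≤ 2 * ((n / 2 : ℕ) : ℝ) + 1 := by
          have : n ≤ 2 * (n / 2) + 1 := by omega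
          exact_mod_cast this
        rw [← sub_nonneg]
        have : (1 + -(2 * d) / (((n / 2 : ℕ) : ℝ) + d + 1)) -
            ((n : ℝ) - ((n / 2 : ℕ) : ℝ) - d) / (((n / 2 : ℕ) : ℝ) + d + 1) =
            (2 * ((n / 2 : ℕ) : ℝ) + 1 - n) / (((n / 2 : ℕ) : ℝ) + d + 1) := by
          field_simp
          ring
        rw [this]
        exact div_nonneg (by linarith) hp.le
    have hmul := ih.mul hratio
    rw [one_mul] at hmul
    refine hmul.congr' ?_
    filter_upwards [eventually_ge_atTop (2 * d)] with n hn
    have hk : n / 2 + d ≤ n := by omega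
    have h := Nat.choose_succ_right_eq n (n / 2 + d)
    have h' := (Nat.cast_inj (R := ℝ)).2 h
    push_cast [Nat.cast_sub hk] at h'
    have hp : (0 : ℝ) < ((n / 2 : ℕ) : ℝ) + d + 1 := by positivity
    have h0 := hpos n
    rw [← add_assoc, div_mul_div_comm, div_eq_div_iff (by positivity) h0.ne']
    linear_combination (-(n.choose (n / 2) : ℝ)) * h'

theorem choose_succ_le_of_half_le {n k : ℕ} (h : n / 2 ≤ k) :
    n.choose (k + 1) ≤ n.choose k := by
  have h1 := Nat.choose_succ_right_eq n k
  have h2 : n.choose k * (n - k) ≤ n.choose k * (k + 1) := Nat.mul_le_mul_left _ (by omega)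
  rw [← h1] at h2
  exact Nat.le_of_mul_le_mul_right h2 (Nat.succ_pos k)

theorem choose_add_le_of_half_le {n k : ℕ} (h : n / 2 ≤ k) (d : ℕ) :
    n.choose (k + d) ≤ n.choose k := by
  induction d with
  | zero => exact le_rfl
  | succ d ih => exact (choose_succ_le_of_half_le (h.trans (Nat.le_add_right k d))).trans ih

/-- Below the middle, reflect k to n - k; the extra 1 absorbs the parity of n. -/
theorem choose_half_add_le {n k m : ℕ} (h1 : n / 2 ≤ k + m) (h2 : k ≤ n / 2 + m) (h3 : k ≤ n) :
    n.choose (n / 2 + m + 1) ≤ n.choose k := by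
  rcases le_total (n / 2) k with hk | hk
  · have := choose_add_le_of_half_le hk (n / 2 + m + 1 - k)
    rwa [show k + (n / 2 + m + 1 - k) = n / 2 + m + 1 by omega] at this
  · have := choose_add_le_of_half_le (n := n) (k := n - k) (by omega) (n / 2 + m + 1 - (n - k))
    rw [show n - k + (n / 2 + m + 1 - (n - k)) = n / 2 + m + 1 by omega] at this
    rwa [Nat.choose_symm h3] at this

theorem card_levels (n k m : ℕ) :
    (levels n k m).card = ∑ i ∈ Finset.range m, n.choose (k + i) := by
  have hmaps : ∀ A ∈ levels n k m, A.card ∈ Finset.Ico k (k + m) := by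
    intro A hA
    exact Finset.mem_Ico.2 (Finset.mem_filter.1 hA).2
  rw [Finset.card_eq_sum_card_fiberwise hmaps, Finset.sum_Ico_eq_sum_range, Nat.add_sub_cancel_left]
  refine Finset.sum_congr rfl fun i hi => ?_
  have hi' := Finset.mem_range.1 hi
  have : (levels n k m).filter (fun A => A.card = k + i) =
      Finset.powersetCard (k + i) Finset.univ := by
    ext A
    simp only [levels, Finset.mem_filter, Finset.mem_univ, true_and, Finset.mem_powersetCard,
      Finset.subset_univ]
    omega
  rw [this, Finset.card_powersetCard, Finset.card_univ, Fintype.card_fin]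

theorem tendsto_card_middleLevels_div (m : ℕ) :
    Tendsto (fun n : ℕ => ((middleLevels n m).card : ℝ) / (n.choose (n / 2) : ℝ)) atTop
      (𝓝 (m : ℝ)) := by
  have hlow := (tendsto_choose_half_add_div (m + 1)).const_mul (m : ℝ)
  rw [mul_one] at hlow
  have hpos : ∀ n : ℕ, (0 : ℝ) < n.choose (n / 2) := fun n => by
    exact_mod_cast Nat.choose_pos (Nat.div_le_self n 2)
  refine tendsto_of_tendsto_of_tendsto_of_le_of_le' hlow tendsto_const_nhds ?_ ?_
  · filter_upwards [eventually_ge_atTop m] with n hn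
    rw [← mul_div_assoc]
    refine div_le_div_of_nonneg_right ?_ (hpos n).le
    have h : ∑ i ∈ Finset.range m, n.choose (n / 2 + m + 1) ≤ (middleLevels n m).card := by
      rw [middleLevels, card_levels]
      refine Finset.sum_le_sum fun i hi => ?_
      have hi' := Finset.mem_range.1 hi
      exact choose_half_add_le (by omega) (by omega) (by omega)
    rw [Finset.sum_const, Finset.card_range, smul_eq_mul] at h
    exact_mod_cast h
  · refine Eventually.of_forall fun n => ?_
    rw [div_le_iff₀ (hpos n)]
    have h : (middleLevels n m).card ≤ ∑ i ∈ Finset.range m, n.choose (n / 2) := by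
      rw [middleLevels, card_levels]
      exact Finset.sum_le_sum fun i _ => Nat.choose_le_middle _ _
    rw [Finset.sum_const, Finset.card_range, smul_eq_mul] at h
    exact_mod_cast h

end MiddleLevels

/-! ### Comparison of the thresholds -/

section Thresholds

theorem card_le_laStar {n : ℕ} {P : Type*} [PartialOrder P] {F : Finset (Finset (Fin n))}
    (hF : PosetFree P F) : F.card ≤ laStar n P := by
  classical
  exact Finset.le_sup (f := Finset.card) (Finset.mem_filter.2 ⟨Finset.mem_univ _, hF⟩)

theorem posetFree_empty {n : ℕ} {P : Type*} [PartialOrder P] [Nonempty P] :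
    PosetFree P (∅ : Finset (Finset (Fin n))) := by
  rintro ⟨f⟩
  exact Finset.notMem_empty _ (f (Classical.arbitrary P)).2

theorem exists_posetFree_card_eq_laStar (n : ℕ) (P : Type*) [PartialOrder P] [Nonempty P] :
    ∃ F : Finset (Finset (Fin n)), PosetFree P F ∧ laStar n P = F.card := by
  classical
  obtain ⟨F, hF, h⟩ := Finset.exists_mem_eq_sup
    (Finset.univ.filter fun F : Finset (Finset (Fin n)) => PosetFree P F)
    ⟨∅, Finset.mem_filter.2 ⟨Finset.mem_univ _, posetFree_empty⟩⟩ Finset.card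
  refine ⟨F, (Finset.mem_filter.1 hF).2, ?_⟩
  rw [← h, laStar]

theorem card_div_choose_le_lubell {n : ℕ} (F : Finset (Finset (Fin n))) :
    (F.card : ℝ) / (n.choose (n / 2) : ℝ) ≤ lubell F := by
  rw [lubell_eq_sum, div_eq_mul_one_div, ← nsmul_eq_mul]
  refine Finset.card_nsmul_le_sum _ _ _ fun A _ => ?_
  have hA : A.card ≤ n := by simpa using A.card_le_univ
  exact one_div_le_one_div_of_le (by exact_mod_cast Nat.choose_pos hA)
    (by exact_mod_cast Nat.choose_le_middle _ _)

theorem turanThreshold_le_strongLubellThreshold (P : Type*) [PartialOrder P] [Nonempty P] :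
    turanThreshold P ≤ strongLubellThreshold P := by
  refine limsup_le_of_le (by isBoundedDefault) (Eventually.of_forall fun n => ?_)
  obtain ⟨F, hF, h⟩ := exists_posetFree_card_eq_laStar n P
  rw [h]
  exact (EReal.coe_le_coe_iff.2 (card_div_choose_le_lubell F)).trans (le_sSup ⟨n, F, hF, rfl⟩)

theorem le_turanThreshold_stdEx (r : ℕ) (hr : 1 ≤ r) :
    (((r : ℝ) - 2 : ℝ) : EReal) ≤ turanThreshold (StdEx r) := by
  obtain ⟨v, hv, hle⟩ : ∃ v : ℕ → ℝ, Tendsto v atTop (𝓝 ((r : ℝ) - 2)) ∧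
      ∀ n, v n ≤ (laStar n (StdEx r) : ℝ) / (n.choose (n / 2) : ℝ) := by
    rcases hr.eq_or_lt with h1 | h2
    -- For r = 1 the claimed lower bound is negative, and no family is needed.
    · refine ⟨fun _ => (r : ℝ) - 2, tendsto_const_nhds, fun n => ?_⟩
      rw [← h1]
      refine le_trans ?_ (div_nonneg (Nat.cast_nonneg _) (Nat.cast_nonneg _))
      norm_num
    · refine ⟨fun n => ((middleLevels n (r - 2)).card : ℝ) / (n.choose (n / 2) : ℝ), ?_,
        fun n => ?_⟩
      · have := tendsto_card_middleLevels_div (r - 2)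
        rwa [Nat.cast_sub (show 2 ≤ r from h2), Nat.cast_ofNat] at this
      · refine div_le_div_of_nonneg_right ?_ (Nat.cast_nonneg _)
        exact_mod_cast card_le_laStar (posetFree_levels h2 n _)
  have hv' : Tendsto (fun n => ((v n : ℝ) : EReal)) atTop (𝓝 (((r : ℝ) - 2 : ℝ) : EReal)) :=
    (continuous_coe_real_ereal.tendsto _).comp hv
  rw [← hv'.limsup_eq]
  exact limsup_le_limsup (Eventually.of_forall fun n => EReal.coe_le_coe_iff.2 (hle n))

end Thresholds

theorem mainTheorem3 (r : ℕ) (hr : 1 ≤ r) :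
    (((r : ℝ) - 2 : ℝ) : EReal) ≤ turanThreshold (StdEx r) ∧
    turanThreshold (StdEx r) ≤ strongLubellThreshold (StdEx r) ∧
    strongLubellThreshold (StdEx r) ≤
      ((2 * (r : ℝ) + Real.sqrt (16 * Real.log 2 * (r : ℝ)) + 11 : ℝ) : EReal) ∧
    (∀ (n : ℕ) (F : Finset (Finset (Fin n))),
      2 * (r : ℝ) + Real.sqrt (16 * Real.log 2 * (r : ℝ)) + 11 < lubell F →
        ContainsCopy (StdEx r) F) ∧
    (2 ≤ r →
      (∀ n k : ℕ, PosetFree (StdEx r) (levels n k (r - 2))) ∧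
      Tendsto (fun n : ℕ => ((middleLevels n (r - 2)).card : ℝ) / (n.choose (n / 2) : ℝ))
        atTop (𝓝 ((r : ℝ) - 2))) := by
  -- Since 16 ln 2 > 9, the square root covers the gap between 11 and 14.
  have hsqrt : 3 ≤ Real.sqrt (16 * Real.log 2 * (r : ℝ)) := by
    refine Real.le_sqrt_of_sq_le ?_
    have h1 : (1 : ℝ) ≤ r := by exact_mod_cast hr
    have h2 := Real.log_two_gt_d9
    nlinarith
  have hbound : ∀ (n : ℕ) (F : Finset (Finset (Fin n))), PosetFree (StdEx r) F →
      lubell F ≤ 2 * (r : ℝ) + Real.sqrt (16 * Real.log 2 * (r : ℝ)) + 11 := by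
    intro n F hF
    have := lubell_le_of_posetFree hF
    linarith
  have : Nonempty (StdEx r) := ⟨.a ⟨0, hr⟩⟩
  refine ⟨le_turanThreshold_stdEx r hr, turanThreshold_le_strongLubellThreshold _, ?_, ?_, ?_⟩
  · refine sSup_le ?_
    rintro _ ⟨n, F, hF, rfl⟩
    exact EReal.coe_le_coe_iff.2 (hbound n F hF)
  · intro n F h
    by_contra hF
    exact absurd (hbound n F hF) (not_le.2 h)
  · intro h2
    refine ⟨posetFree_levels h2, ?_⟩
    have := tendsto_card_middleLevels_div (r - 2)
    rwa [Nat.cast_sub h2, Nat.cast_ofNat] at this
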